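/- Let $d\in\mathbb{N}$, let $D\subset\mathbb{R}^d$ be open, let $\Lambda>0$, $C>0$, $\overline\varepsilon>0$, and let $\phi:D\to[0,+\infty]$ be a function in $H^1(D)$ (so $\phi$ is finite almost everywhere, $\phi\in L^2(D)$, and its weak gradient $\nabla\phi$ is in $L^2(D;\mathbb{R}^d)$). For a measurable set $A$ let $$P(A;D)=\sup\Big\{\int_{A\cap D}\operatorname{div}X\,dx \;:\; X\in C^1_c(D;\mathbb{R}^d),\ |X|\le 1\Big\}\in[0,+\infty]$$ be the perimeter of $A$ in $D$. 1. If $$\int_{\{0\le\phi\le\varepsilon\}\cap D}|\nabla\phi|^2\,dx+\Lambda\,\big|\{0\le\phi\le\varepsilon\}\cap D\big|\le C\varepsilon\qquad\text{for every }0<\varepsilon\le\overline\varepsilon,$$ then $P(\{\phi>0\};D)\le C\sqrt{\Lambda}$. 2. If only $$\int_{\{0<\phi\le\varepsilon\}\cap D}|\nabla\phi|^2\,dx+\Lambda\,\big|\{0<\phi\le\varepsilon\}\cap D\big|\le C\varepsilon\qquad\text{for every }0<\varepsilon\le\overline\varepsilon,$$ then $P(\{\phi>0\};D)\le \dfrac{C}{\sqrt{\Lambda}}$.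 -/

import Mathlib

open MeasureTheory
open scoped ENNReal ContDiff InnerProductSpace

/-- `u` belongs to the Sobolev space `H¹(D)` and `G` is (a representative of) its weak gradient:
`u` and `G` are square integrable on `D` and `∫_D u ∂_v ψ = - ∫_D (G · v) ψ` for every test
function `ψ ∈ C_c^∞(D)` and every direction `v`. Only the values on `D` matter, and `G` is
determined by `u` up to a null subset of `D`. -/
structure IsH1WithGradient {d : ℕ} (D : Set (EuclideanSpace ℝ (Fin d)))
    (u : EuclideanSpace ℝ (Fin d) → ℝ)
    (G : EuclideanSpace ℝ (Fin d) → EuclideanSpace ℝ (Fin d)) : Prop where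
  memLp_fun : MemLp u 2 (volume.restrict D)
  memLp_gradient : MemLp G 2 (volume.restrict D)
  integral_by_parts : ∀ ψ : EuclideanSpace ℝ (Fin d) → ℝ,
    ContDiff ℝ ∞ ψ → HasCompactSupport ψ → tsupport ψ ⊆ D →
      ∀ v : EuclideanSpace ℝ (Fin d),
        ∫ x in D, u x * fderiv ℝ ψ x v = - ∫ x in D, ⟪G x, v⟫_ℝ * ψ x

/-- The divergence `∑ᵢ ∂ᵢ Xᵢ` of a vector field. -/
noncomputable def divergence {d : ℕ}
    (X : EuclideanSpace ℝ (Fin d) → EuclideanSpace ℝ (Fin d))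
    (x : EuclideanSpace ℝ (Fin d)) : ℝ :=
  ∑ i : Fin d, (fderiv ℝ X x (EuclideanSpace.single i 1)) i

/-- The (De Giorgi) perimeter `P(A; D)` of a Lebesgue measurable set `A` in the open set `D`:
the supremum, in `[0, ∞]`, of `∫_{A ∩ D} div X` over all `X ∈ C_c^1(D; ℝ^d)` with `|X| ≤ 1`.
(As `X = 0` is admissible, negative values of the integral do not matter.) -/
noncomputable def perimeter {d : ℕ} (A D : Set (EuclideanSpace ℝ (Fin d))) : ℝ≥0∞ :=
  ⨆ (X : EuclideanSpace ℝ (Fin d) → EuclideanSpace ℝ (Fin d))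
    (_ : ContDiff ℝ 1 X ∧ HasCompactSupport X ∧ tsupport X ⊆ D ∧ ∀ x, ‖X x‖ ≤ 1),
    ENNReal.ofReal (∫ x in A ∩ D, divergence X x)

/-!
The indicator of `{φ > 0}` is the bounded limit of `θ (φ / ε)` as `ε → 0`, where `θ` is a `C¹` step
from `0` to `1` on `[0, 1]` with `|θ'| ≤ 2`. For an admissible vector field `X`, the chain rule in
`H¹(D)` gives
`∫_D θ(φ/ε) div X = -∫_D ε⁻¹ θ'(φ/ε) ∇φ · X ≤ (2/ε) ∫_{0 < φ ≤ ε} |∇φ|`,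
and `2 |∇φ| √Λ ≤ |∇φ|² + Λ` bounds the right-hand side by `(ε √Λ)⁻¹ C ε = C / √Λ`. This is the
second bound. In the first one the set `{0 ≤ φ ≤ ε}` contains `{φ = 0}`, which must therefore be a
null set; so `∫_{φ > 0} div X = ∫_D div X = 0` and the perimeter vanishes.

The chain rule (`IsH1WithGradient.integral_comp_mul_fderiv`) is proved by multiplying with a cutoff
and mollifying: mollification commutes with the weak derivative (`fderiv_mollification_apply`), the
mollified functions converge almost everywhere, and their derivatives converge in `L¹`
(`tendsto_integral_abs_mollification_sub`), which suffices to pass to the limit in the classical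
integration by parts.
-/

open Filter Topology ContinuousLinearMap
open scoped Convolution

/-! ### Mollification in `L¹` -/

/-- **Scheffé's lemma**: nonnegative functions that converge almost everywhere and all have the
integral of the limit converge in `L¹`. -/
theorem tendsto_integral_abs_sub_of_nonneg {α : Type*} [MeasurableSpace α] {μ : Measure α}
    {f : ℕ → α → ℝ} {g : α → ℝ} (hf : ∀ n, Integrable (f n) μ) (hg : Integrable g μ)
    (hf0 : ∀ n x, 0 ≤ f n x) (hint : ∀ n, ∫ x, f n x ∂μ = ∫ x, g x ∂μ)
    (hlim : ∀ᵐ x ∂μ, Tendsto (fun n => f n x) atTop (𝓝 (g x))) :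
    Tendsto (fun n => ∫ x, |f n x - g x| ∂μ) atTop (𝓝 0) := by
  have key : ∀ n, ∫ x, |f n x - g x| ∂μ = 2 * ∫ x, max (g x - f n x) 0 ∂μ := by
    intro n
    -- The positive part of `g - f n` is dominated by `|g|`, since `f n ≥ 0`; the negative part is
    -- controlled by it because `f n` and `g` have the same integral.
    have h1 : ∀ x, |f n x - g x| = (f n x - g x) + 2 * max (g x - f n x) 0 := by
      intro x
      rcases le_total (g x) (f n x) with h | h
      · rw [abs_of_nonneg (by linarith), max_eq_right (by linarith)]; ring
      · rw [abs_of_nonpos (by linarith), max_eq_left (by linarith)]; ring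
    have hpos : Integrable (fun x => max (g x - f n x) 0) μ := (hg.sub (hf n)).pos_part
    have hsub : Integrable (fun x => f n x - g x) μ := (hf n).sub hg
    simp_rw [h1]
    rw [integral_add hsub (hpos.const_mul 2), integral_sub (hf n) hg, hint n, integral_const_mul]
    ring
  simp_rw [key]
  have : Tendsto (fun n => ∫ x, max (g x - f n x) 0 ∂μ) atTop (𝓝 (∫ _, (0 : ℝ) ∂μ)) := by
    refine tendsto_integral_of_dominated_convergence (fun x => |g x|)
      (fun n => (hg.sub (hf n)).pos_part.aestronglyMeasurable) hg.abs (fun n => ?_) ?_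
    · refine Eventually.of_forall fun x => ?_
      rw [Real.norm_eq_abs, abs_of_nonneg (le_max_right _ _)]
      exact max_le (by linarith [hf0 n x, le_abs_self (g x)]) (abs_nonneg _)
    · filter_upwards [hlim] with x hx
      simpa using ((tendsto_const_nhds (x := g x)).sub hx).max (tendsto_const_nhds (x := (0 : ℝ)))
  simpa using this.const_mul 2

section Mollification

variable {E : Type*} [NormedAddCommGroup E] [NormedSpace ℝ E] [FiniteDimensional ℝ E]
  [MeasurableSpace E] [BorelSpace E] {μ : Measure E} [μ.IsAddHaarMeasure]

/-- Mollifications of an integrable function converge to it in `L¹`. For nonnegative functions this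
is Scheffé's lemma, as mollification preserves the integral and converges almost everywhere; the
general case follows by splitting into positive and negative parts. -/
theorem tendsto_integral_abs_mollification_sub {ρ : ℕ → ContDiffBump (0 : E)} {K : ℝ}
    (hρ : Tendsto (fun n => (ρ n).rOut) atTop (𝓝 0)) (hK : ∀ n, (ρ n).rOut ≤ K * (ρ n).rIn)
    {g : E → ℝ} (hg : Integrable g μ) :
    Tendsto (fun n => ∫ x, |((ρ n).normed μ ⋆[lsmul ℝ ℝ, μ] g) x - g x| ∂μ) atTop (𝓝 0) := by
  have hconv : ∀ n {f : E → ℝ}, Integrable f μ →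
      Integrable ((ρ n).normed μ ⋆[lsmul ℝ ℝ, μ] f) μ := fun n f hf =>
    (ρ n).integrable_normed.integrable_convolution _ hf
  have hnn : ∀ {f : E → ℝ}, Integrable f μ → (∀ x, 0 ≤ f x) →
      Tendsto (fun n => ∫ x, |((ρ n).normed μ ⋆[lsmul ℝ ℝ, μ] f) x - f x| ∂μ) atTop (𝓝 0) := by
    intro f hf hf0
    refine tendsto_integral_abs_sub_of_nonneg (fun n => hconv n hf) hf (fun n x => ?_)
      (fun n => ?_) ?_
    · exact integral_nonneg fun t => mul_nonneg ((ρ n).nonneg_normed t) (hf0 _)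
    · rw [integral_convolution _ (ρ n).integrable_normed hf, (ρ n).integral_normed]
      simp
    · exact ContDiffBump.ae_convolution_tendsto_right_of_locallyIntegrable hρ
        (Eventually.of_forall hK) hf.locallyIntegrable
  obtain ⟨p, m, hp, hm, hp0, hm0, hpm⟩ : ∃ p m : E → ℝ, Integrable p μ ∧ Integrable m μ ∧
      (∀ x, 0 ≤ p x) ∧ (∀ x, 0 ≤ m x) ∧ g = fun x => p x - m x := by
    refine ⟨fun x => max (g x) 0, fun x => max (-g x) 0, hg.pos_part, hg.neg_part,
      fun x => le_max_right _ _, fun x => le_max_right _ _, funext fun x => ?_⟩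
    change g x = max (g x) 0 - max (-g x) 0
    rcases le_total (g x) 0 with h | h
    · rw [max_eq_right h, max_eq_left (by linarith)]; ring
    · rw [max_eq_left h, max_eq_right (by linarith)]; ring
  have hdiff : ∀ n {f : E → ℝ}, Integrable f μ →
      Integrable (fun x => |((ρ n).normed μ ⋆[lsmul ℝ ℝ, μ] f) x - f x|) μ := fun n f hf =>
    ((hconv n hf).sub hf).abs
  refine squeeze_zero (fun n => integral_nonneg fun x => abs_nonneg _) (fun n => ?_)
    (by simpa using (hnn hp hp0).add (hnn hm hm0))
  rw [← integral_add (hdiff n hp) (hdiff n hm)]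
  refine integral_mono (hdiff n hg) ((hdiff n hp).add (hdiff n hm)) fun x => ?_
  have hex : ∀ {f : E → ℝ}, Integrable f μ →
      Integrable (fun t => (ρ n).normed μ t * f (x - t)) μ := fun hf =>
    (ρ n).hasCompactSupport_normed.convolutionExists_left (lsmul ℝ ℝ)
      (ρ n).continuous_normed hf.locallyIntegrable x
  have hlin : ((ρ n).normed μ ⋆[lsmul ℝ ℝ, μ] g) x
      = ((ρ n).normed μ ⋆[lsmul ℝ ℝ, μ] p) x - ((ρ n).normed μ ⋆[lsmul ℝ ℝ, μ] m) x := by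
    simp only [convolution_def, lsmul_apply, smul_eq_mul, hpm]
    rw [← integral_sub (hex hp) (hex hm)]
    simp only [mul_sub]
  simp only [hlin]
  rw [hpm, show ∀ a b c d : ℝ, a - b - (c - d) = (a - c) - (b - d) by intros; ring]
  exact abs_sub _ _

/-- If `g` is the weak derivative of `w` in the direction `v`, then the mollification of `g` is the
classical derivative of the mollification of `w`: differentiate the kernel, and use
`y ↦ ρ (x - y)` as a test function. -/
theorem fderiv_mollification_apply (ρ : ContDiffBump (0 : E)) {w g : E → ℝ} {v : E}
    (hw : LocallyIntegrable w μ)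
    (hweak : ∀ ψ : E → ℝ, ContDiff ℝ ∞ ψ → HasCompactSupport ψ →
      ∫ x, w x * fderiv ℝ ψ x v ∂μ = -∫ x, g x * ψ x ∂μ) (x : E) :
    fderiv ℝ (ρ.normed μ ⋆[lsmul ℝ ℝ, μ] w) x v = (ρ.normed μ ⋆[lsmul ℝ ℝ, μ] g) x := by
  have hsm : ContDiff ℝ ∞ (ρ.normed μ) := ρ.contDiff_normed
  have hcs := ρ.hasCompactSupport_normed (μ := μ)
  rw [(hcs.hasFDerivAt_convolution_left (lsmul ℝ ℝ) (hsm.of_le (by simp)) hw x).fderiv]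
  have hex := (hcs.fderiv (𝕜 := ℝ)).convolutionExists_left
    ((lsmul ℝ ℝ : ℝ →L[ℝ] ℝ →L[ℝ] ℝ).precompL E)
    (hsm.continuous_fderiv (by simp)) hw x
  have hψ : ContDiff ℝ ∞ (fun y => ρ.normed μ (x - y)) := hsm.comp (contDiff_const.sub contDiff_id)
  have hψc : HasCompactSupport (fun y => ρ.normed μ (x - y)) :=
    hcs.comp_homeomorph (Homeomorph.subLeft x)
  have hd : ∀ y, fderiv ℝ (fun y => ρ.normed μ (x - y)) y v
      = - fderiv ℝ (ρ.normed μ) (x - y) v := by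
    intro y
    have h1 : HasFDerivAt (fun y => ρ.normed μ (x - y))
        ((fderiv ℝ (ρ.normed μ) (x - y)).comp (-ContinuousLinearMap.id ℝ E)) y :=
      ((hsm.differentiable (by simp)) (x - y)).hasFDerivAt.comp y
        ((hasFDerivAt_id y).const_sub x)
    rw [h1.fderiv]
    simp
  have h := hweak _ hψ hψc
  simp_rw [hd] at h
  rw [convolution_def, ContinuousLinearMap.integral_apply hex, convolution_def]
  simp only [precompL_apply, lsmul_apply, smul_eq_mul]
  rw [← integral_sub_left_eq_self (fun t => fderiv ℝ (ρ.normed μ) t v * w (x - t)) μ x,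
    ← integral_sub_left_eq_self (fun t => ρ.normed μ t * g (x - t)) μ x]
  simp only [sub_sub_cancel]
  simp only [mul_neg, integral_neg, neg_inj] at h
  simpa only [mul_comm] using h

/-- **Chain rule for weak derivatives** on the whole space: if `g` is the weak derivative of `w` in
the direction `v`, then `h'(w) g` is that of `h(w)`, for `h` of class `C¹` with `h` and `h'`
bounded. The test function `ψ` need only be `C¹`. -/
theorem integral_comp_mul_fderiv_eq_neg {w g : E → ℝ} {v : E}
    (hw : Integrable w μ) (hg : Integrable g μ)
    (hweak : ∀ ψ : E → ℝ, ContDiff ℝ ∞ ψ → HasCompactSupport ψ →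
      ∫ x, w x * fderiv ℝ ψ x v ∂μ = -∫ x, g x * ψ x ∂μ)
    {h h' : ℝ → ℝ} (hderiv : ∀ t, HasDerivAt h (h' t) t) (hcont : Continuous h')
    {M M' : ℝ} (hM : ∀ t, |h t| ≤ M) (hM' : ∀ t, |h' t| ≤ M')
    {ψ : E → ℝ} (hψ : ContDiff ℝ 1 ψ) (hψc : HasCompactSupport ψ) :
    ∫ x, h (w x) * fderiv ℝ ψ x v ∂μ = -∫ x, h' (w x) * g x * ψ x ∂μ := by
  let ρ : ℕ → ContDiffBump (0 : E) := fun n =>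
    { rIn := 1 / ((n : ℝ) + 1)
      rOut := 2 * (1 / ((n : ℝ) + 1))
      rIn_pos := by positivity
      rIn_lt_rOut := by
        have : (0 : ℝ) < 1 / ((n : ℝ) + 1) := by positivity
        linarith }
  have hρ : Tendsto (fun n => (ρ n).rOut) atTop (𝓝 0) := by
    simpa only [mul_zero] using (tendsto_one_div_add_atTop_nhds_zero_nat (𝕜 := ℝ)).const_mul 2
  have hK : ∀ n, (ρ n).rOut ≤ 2 * (ρ n).rIn := fun n => le_rfl
  set W : ℕ → E → ℝ := fun n => (ρ n).normed μ ⋆[lsmul ℝ ℝ, μ] w with hW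
  set H : ℕ → E → ℝ := fun n => (ρ n).normed μ ⋆[lsmul ℝ ℝ, μ] g with hH
  have hWlim : ∀ᵐ x ∂μ, Tendsto (fun n => W n x) atTop (𝓝 (w x)) :=
    ContDiffBump.ae_convolution_tendsto_right_of_locallyIntegrable hρ
      (Eventually.of_forall hK) hw.locallyIntegrable
  have hHlim := tendsto_integral_abs_mollification_sub hρ hK hg
  have hWsm : ∀ n, ContDiff ℝ 1 (W n) := fun n =>
    (ρ n).hasCompactSupport_normed.contDiff_convolution_left (n := 1) _
      (ρ n).contDiff_normed hw.locallyIntegrable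
  have hHc : ∀ n, Continuous (H n) := fun n =>
    (ρ n).hasCompactSupport_normed.continuous_convolution_left _
      (ρ n).continuous_normed hg.locallyIntegrable
  have hHi : ∀ n, Integrable (H n) μ := fun n =>
    (ρ n).integrable_normed.integrable_convolution _ hg
  have hh : Continuous h := continuous_iff_continuousAt.2 fun t => (hderiv t).continuousAt
  have hψd : Continuous (fun x => fderiv ℝ ψ x v) :=
    (hψ.continuous_fderiv (by simp)).clm_apply continuous_const
  have hψdc : HasCompactSupport (fun x => fderiv ℝ ψ x v) := hψc.fderiv_apply (𝕜 := ℝ) v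
  have hψi : Integrable (fun x => fderiv ℝ ψ x v) μ := hψd.integrable_of_hasCompactSupport hψdc
  obtain ⟨B, hB⟩ := hψ.continuous.bounded_above_of_compact_support hψc
  -- The classical identity for the mollified function.
  have hn : ∀ n, ∫ x, h (W n x) * fderiv ℝ ψ x v ∂μ = -∫ x, h' (W n x) * H n x * ψ x ∂μ := by
    intro n
    have hfd : ∀ x, HasFDerivAt (fun x => h (W n x)) (h' (W n x) • fderiv ℝ (W n) x) x := fun x =>
      (hderiv (W n x)).comp_hasFDerivAt x ((hWsm n).differentiable (by simp) x).hasFDerivAt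
    have hfd' : ∀ x, fderiv ℝ (fun x => h (W n x)) x v = h' (W n x) * H n x := fun x => by
      rw [(hfd x).fderiv, smul_apply, smul_eq_mul,
        fderiv_mollification_apply (ρ n) hw.locallyIntegrable hweak x]
    have hc := (hWsm n).continuous
    rw [integral_mul_fderiv_eq_neg_fderiv_mul_of_integrable _ _ _
      (fun x _ => (hfd x).differentiableAt) (fun x _ => hψ.differentiable (by simp) x)]
    · simp_rw [hfd']
    · simp_rw [hfd']
      exact (((hcont.comp hc).mul (hHc n)).mul hψ.continuous).integrable_of_hasCompactSupport
        hψc.mul_left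
    · exact ((hh.comp hc).mul hψd).integrable_of_hasCompactSupport hψdc.mul_left
    · exact ((hh.comp hc).mul hψ.continuous).integrable_of_hasCompactSupport hψc.mul_left
  have hleft : Tendsto (fun n => ∫ x, h (W n x) * fderiv ℝ ψ x v ∂μ) atTop
      (𝓝 (∫ x, h (w x) * fderiv ℝ ψ x v ∂μ)) := by
    refine tendsto_integral_of_dominated_convergence (fun x => M * |fderiv ℝ ψ x v|)
      (fun n => ((hh.comp (hWsm n).continuous).mul hψd).aestronglyMeasurable)
      (hψi.abs.const_mul M) (fun n => Eventually.of_forall fun x => ?_) ?_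
    · rw [Real.norm_eq_abs, abs_mul]
      exact mul_le_mul_of_nonneg_right (hM _) (abs_nonneg _)
    · filter_upwards [hWlim] with x hx
      exact ((hh.tendsto _).comp hx).mul_const _
  have hM0 : 0 ≤ M' := (abs_nonneg _).trans (hM' 0)
  have hB0 : 0 ≤ B := (norm_nonneg _).trans (hB 0)
  have hgψ : Integrable (fun x => M' * |g x| * B) μ := (hg.abs.const_mul _).mul_const _
  have hbd : ∀ (s : ℝ) (a : ℝ) (x : E), ‖h' s * a * ψ x‖ ≤ M' * |a| * B := by
    intro s a x
    rw [norm_mul, norm_mul, Real.norm_eq_abs (h' s), Real.norm_eq_abs a]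
    gcongr
    · exact hM' s
    · exact hB x
  have hmeas : ∀ n {k : E → ℝ}, AEStronglyMeasurable k μ →
      AEStronglyMeasurable (fun x => h' (W n x) * k x * ψ x) μ := fun n k hk =>
    ((hcont.comp (hWsm n).continuous).aestronglyMeasurable.mul hk).mul
      hψ.continuous.aestronglyMeasurable
  have hright1 : Tendsto (fun n => ∫ x, h' (W n x) * g x * ψ x ∂μ) atTop
      (𝓝 (∫ x, h' (w x) * g x * ψ x ∂μ)) := by
    refine tendsto_integral_of_dominated_convergence _
      (fun n => hmeas n hg.aestronglyMeasurable) hgψ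
      (fun n => Eventually.of_forall fun x => hbd _ _ _) ?_
    filter_upwards [hWlim] with x hx
    exact (((hcont.tendsto _).comp hx).mul_const _).mul_const _
  -- The values `h' (W n x)` are bounded uniformly, so `L¹` convergence of `H n` is enough here.
  have hright2 : Tendsto (fun n => ∫ x, h' (W n x) * (H n x - g x) * ψ x ∂μ) atTop (𝓝 0) := by
    refine squeeze_zero_norm (fun n => ?_)
      (by simpa using (hHlim.const_mul M').mul_const B)
    refine (norm_integral_le_of_norm_le ((((hHi n).sub hg).abs.const_mul M').mul_const B)
      (Eventually.of_forall fun x => hbd _ _ _)).trans (le_of_eq ?_)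
    rw [integral_mul_const, integral_const_mul]
    rfl
  have hright : Tendsto (fun n => ∫ x, h' (W n x) * H n x * ψ x ∂μ) atTop
      (𝓝 (∫ x, h' (w x) * g x * ψ x ∂μ)) := by
    have := hright1.add hright2
    rw [add_zero] at this
    refine this.congr fun n => ?_
    rw [← integral_add]
    · refine integral_congr_ae (Eventually.of_forall fun x => ?_)
      simp only
      ring
    · exact hgψ.mono' (hmeas n hg.aestronglyMeasurable) (Eventually.of_forall fun x => hbd _ _ _)
    · exact (((((hHi n).sub hg).abs.const_mul M').mul_const B)).mono'
        (hmeas n ((hHi n).sub hg).aestronglyMeasurable) (Eventually.of_forall fun x => hbd _ _ _)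
  exact tendsto_nhds_unique hleft (by simpa only [hn] using hright.neg)

end Mollification

/-! ### The chain rule in `H¹(D)` -/

theorem exists_smooth_cutoff {E : Type*} [NormedAddCommGroup E] [NormedSpace ℝ E]
    [FiniteDimensional ℝ E] {K D : Set E} (hK : IsCompact K) (hD : IsOpen D) (hKD : K ⊆ D) :
    ∃ η : E → ℝ, ContDiff ℝ ∞ η ∧ HasCompactSupport η ∧ tsupport η ⊆ D ∧
      ∀ x ∈ K, η =ᶠ[𝓝 x] fun _ => 1 := by
  obtain ⟨L, hL, hKL, hLD⟩ := exists_compact_between hK hD hKD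
  obtain ⟨f, hf1, hf0, -⟩ := exists_contMDiffMap_one_nhds_of_subset_interior
    (n := (⊤ : ℕ∞)) (modelWithCornersSelf ℝ E) hK.isClosed hKL
  have hsupp : tsupport f ⊆ L := closure_minimal
    (fun x hx => by_contra fun hxL => hx (hf0 x hxL)) hL.isClosed
  exact ⟨f, f.contMDiff.contDiff, hL.of_isClosed_subset (isClosed_tsupport _) hsupp,
    hsupp.trans hLD, fun x hx => (Filter.eventually_iff.1 hf1 |> mem_nhdsSet_iff_forall.1) x hx⟩

section WeakGradient

variable {d : ℕ} {D : Set (EuclideanSpace ℝ (Fin d))} {u : EuclideanSpace ℝ (Fin d) → ℝ}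
  {G : EuclideanSpace ℝ (Fin d) → EuclideanSpace ℝ (Fin d)}

theorem IsH1WithGradient.integrable_mul (hu : IsH1WithGradient D u G)
    {k : EuclideanSpace ℝ (Fin d) → ℝ} (hk : Continuous k) (hkc : HasCompactSupport k) :
    Integrable (fun x => u x * k x) (volume.restrict D) :=
  hu.memLp_fun.integrable_mul (hk.memLp_of_hasCompactSupport hkc : MemLp k 2 _)

theorem IsH1WithGradient.integrable_inner_mul (hu : IsH1WithGradient D u G)
    (v : EuclideanSpace ℝ (Fin d))
    {k : EuclideanSpace ℝ (Fin d) → ℝ} (hk : Continuous k) (hkc : HasCompactSupport k) :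
    Integrable (fun x => ⟪G x, v⟫_ℝ * k x) (volume.restrict D) :=
  (hu.memLp_gradient.inner_const v).integrable_mul
    (hk.memLp_of_hasCompactSupport hkc : MemLp k 2 _)

/-- A function `u ∈ H¹(D)` times a cutoff `η ∈ C_c^∞(D)` has the weak derivative
`η ∂ᵥu + u ∂ᵥη` on the whole space. -/
theorem IsH1WithGradient.integral_mul_cutoff (hu : IsH1WithGradient D u G)
    {η : EuclideanSpace ℝ (Fin d) → ℝ} (hη : ContDiff ℝ ∞ η) (hηc : HasCompactSupport η)
    (hηD : tsupport η ⊆ D) (v : EuclideanSpace ℝ (Fin d))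
    {ψ : EuclideanSpace ℝ (Fin d) → ℝ} (hψ : ContDiff ℝ ∞ ψ) :
    ∫ x, u x * η x * fderiv ℝ ψ x v
      = -∫ x, (⟪G x, v⟫_ℝ * η x + u x * fderiv ℝ η x v) * ψ x := by
  have hη0 : ∀ x, x ∉ D → η x = 0 := fun x hx =>
    image_eq_zero_of_notMem_tsupport fun h => hx (hηD h)
  have hdη0 : ∀ x, x ∉ D → fderiv ℝ η x v = 0 := fun x hx => by
    rw [fderiv_of_notMem_tsupport ℝ fun h => hx (hηD h)]; rfl
  rw [← setIntegral_eq_integral_of_forall_compl_eq_zero (s := D)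
      (f := fun x => u x * η x * fderiv ℝ ψ x v) (fun x hx => by rw [hη0 x hx]; ring),
    ← setIntegral_eq_integral_of_forall_compl_eq_zero (s := D)
      (f := fun x => (⟪G x, v⟫_ℝ * η x + u x * fderiv ℝ η x v) * ψ x)
      (fun x hx => by rw [hη0 x hx, hdη0 x hx]; ring)]
  have hprod : ∀ x, fderiv ℝ (fun y => η y * ψ y) x v
      = η x * fderiv ℝ ψ x v + ψ x * fderiv ℝ η x v := fun x => by
    rw [fderiv_fun_mul (hη.differentiable (by simp) x) (hψ.differentiable (by simp) x)]
    rfl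
  have hdψ : Continuous (fun x => fderiv ℝ ψ x v) :=
    (hψ.continuous_fderiv (by simp)).clm_apply continuous_const
  have hdη : Continuous (fun x => fderiv ℝ η x v) :=
    (hη.continuous_fderiv (by simp)).clm_apply continuous_const
  have hdηc : HasCompactSupport (fun x => fderiv ℝ η x v) := hηc.fderiv_apply (𝕜 := ℝ) v
  have h := hu.integral_by_parts (fun y => η y * ψ y) (hη.mul hψ) hηc.mul_right
    ((tsupport_mul_subset_left (f := η) (g := ψ)).trans hηD) v
  have i1 : Integrable (fun x => u x * (η x * fderiv ℝ ψ x v)) (volume.restrict D) :=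
    hu.integrable_mul (hη.continuous.mul hdψ) hηc.mul_right
  have i2 : Integrable (fun x => u x * (fderiv ℝ η x v * ψ x)) (volume.restrict D) :=
    hu.integrable_mul (hdη.mul hψ.continuous) hdηc.mul_right
  have i3 : Integrable (fun x => ⟪G x, v⟫_ℝ * (η x * ψ x)) (volume.restrict D) :=
    hu.integrable_inner_mul v (hη.continuous.mul hψ.continuous) hηc.mul_right
  have e1 : ∫ x in D, u x * fderiv ℝ (fun y => η y * ψ y) x v
      = (∫ x in D, u x * η x * fderiv ℝ ψ x v) + ∫ x in D, u x * (fderiv ℝ η x v * ψ x) := by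
    simp only [mul_assoc]
    rw [← integral_add i1 i2]
    refine integral_congr_ae (Eventually.of_forall fun x => ?_)
    simp only [hprod]
    ring
  have e2 : ∫ x in D, (⟪G x, v⟫_ℝ * η x + u x * fderiv ℝ η x v) * ψ x
      = (∫ x in D, ⟪G x, v⟫_ℝ * (η x * ψ x)) + ∫ x in D, u x * (fderiv ℝ η x v * ψ x) := by
    rw [← integral_add i3 i2]
    refine integral_congr_ae (Eventually.of_forall fun x => ?_)
    simp only
    ring
  linarith

/-- **Chain rule** in `H¹(D)`, tested against `ψ ∈ C_c^1(D)`. A cutoff that equals `1` near the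
support of `ψ` reduces it to the chain rule on the whole space. -/
theorem IsH1WithGradient.integral_comp_mul_fderiv (hD : IsOpen D) (hu : IsH1WithGradient D u G)
    {h h' : ℝ → ℝ} (hderiv : ∀ t, HasDerivAt h (h' t) t) (hcont : Continuous h')
    {M M' : ℝ} (hM : ∀ t, |h t| ≤ M) (hM' : ∀ t, |h' t| ≤ M')
    {ψ : EuclideanSpace ℝ (Fin d) → ℝ} (hψ : ContDiff ℝ 1 ψ) (hψc : HasCompactSupport ψ)
    (hψD : tsupport ψ ⊆ D) (v : EuclideanSpace ℝ (Fin d)) :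
    ∫ x in D, h (u x) * fderiv ℝ ψ x v = -∫ x in D, h' (u x) * ⟪G x, v⟫_ℝ * ψ x := by
  obtain ⟨η, hη, hηc, hηD, hη1⟩ := exists_smooth_cutoff hψc hD hψD
  have hη0 : ∀ x, x ∉ D → η x = 0 := fun x hx =>
    image_eq_zero_of_notMem_tsupport fun h => hx (hηD h)
  have hdη0 : ∀ x, x ∉ D → fderiv ℝ η x v = 0 := fun x hx => by
    rw [fderiv_of_notMem_tsupport ℝ fun h => hx (hηD h)]; rfl
  have hdη : Continuous (fun x => fderiv ℝ η x v) :=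
    (hη.continuous_fderiv (by simp)).clm_apply continuous_const
  have hw : Integrable (fun x => u x * η x) := by
    refine IntegrableOn.integrable_of_forall_notMem_eq_zero (s := D)
      (hu.integrable_mul hη.continuous hηc) fun x hx => ?_
    rw [hη0 x hx, mul_zero]
  have hg : Integrable (fun x => ⟪G x, v⟫_ℝ * η x + u x * fderiv ℝ η x v) := by
    refine IntegrableOn.integrable_of_forall_notMem_eq_zero (s := D)
      ((hu.integrable_inner_mul v hη.continuous hηc).add
        (hu.integrable_mul hdη (hηc.fderiv_apply (𝕜 := ℝ) v))) fun x hx => ?_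
    rw [hη0 x hx, hdη0 x hx]
    ring
  have key := integral_comp_mul_fderiv_eq_neg hw hg
    (fun ψ hψ _ => hu.integral_mul_cutoff hη hηc hηD v hψ) hderiv hcont hM hM' hψ hψc
  have hψ0 : ∀ x, x ∉ tsupport ψ → ψ x = 0 := fun x => image_eq_zero_of_notMem_tsupport
  have hdψ0 : ∀ x, x ∉ tsupport ψ → fderiv ℝ ψ x v = 0 := fun x hx => by
    rw [fderiv_of_notMem_tsupport ℝ hx]; rfl
  have e1 : ∀ x, h (u x * η x) * fderiv ℝ ψ x v = h (u x) * fderiv ℝ ψ x v := fun x => by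
    by_cases hx : x ∈ tsupport ψ
    · rw [(hη1 x hx).eq_of_nhds, mul_one]
    · rw [hdψ0 x hx, mul_zero, mul_zero]
  have e2 : ∀ x, h' (u x * η x) * (⟪G x, v⟫_ℝ * η x + u x * fderiv ℝ η x v) * ψ x
      = h' (u x) * ⟪G x, v⟫_ℝ * ψ x := fun x => by
    by_cases hx : x ∈ tsupport ψ
    · rw [(hη1 x hx).eq_of_nhds, (hη1 x hx).fderiv_eq]
      simp
    · rw [hψ0 x hx, mul_zero, mul_zero]
  simp_rw [e1, e2] at key
  rw [setIntegral_eq_integral_of_forall_compl_eq_zero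
      (f := fun x => h (u x) * fderiv ℝ ψ x v)
      (fun x hx => by rw [hdψ0 x fun h => hx (hψD h), mul_zero]),
    setIntegral_eq_integral_of_forall_compl_eq_zero
      (f := fun x => h' (u x) * ⟪G x, v⟫_ℝ * ψ x)
      (fun x hx => by rw [hψ0 x fun h => hx (hψD h), mul_zero])]
  exact key

theorem fderiv_euclidean_apply {X : EuclideanSpace ℝ (Fin d) → EuclideanSpace ℝ (Fin d)}
    {x : EuclideanSpace ℝ (Fin d)} (hX : DifferentiableAt ℝ X x) (i : Fin d)
    (v : EuclideanSpace ℝ (Fin d)) :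
    fderiv ℝ (fun y => X y i) x v = (fderiv ℝ X x v) i := by
  have h : HasFDerivAt (fun y => X y i)
      ((EuclideanSpace.proj (𝕜 := ℝ) i : EuclideanSpace ℝ (Fin d) →L[ℝ] ℝ).comp (fderiv ℝ X x)) x :=
    (EuclideanSpace.proj (𝕜 := ℝ) i : EuclideanSpace ℝ (Fin d) →L[ℝ] ℝ).hasFDerivAt.comp x
      hX.hasFDerivAt
  rw [h.fderiv]
  rfl

theorem continuous_divergence {X : EuclideanSpace ℝ (Fin d) → EuclideanSpace ℝ (Fin d)}
    (hX : ContDiff ℝ 1 X) : Continuous (divergence X) := by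
  refine continuous_finsetSum _ fun i _ => ?_
  exact (EuclideanSpace.proj (𝕜 := ℝ) i : EuclideanSpace ℝ (Fin d) →L[ℝ] ℝ).continuous.comp
    ((hX.continuous_fderiv (by simp)).clm_apply continuous_const)

theorem hasCompactSupport_divergence {X : EuclideanSpace ℝ (Fin d) → EuclideanSpace ℝ (Fin d)}
    (hX : HasCompactSupport X) : HasCompactSupport (divergence X) :=
  hX.mono' fun x hx => by
    contrapose! hx
    simp [divergence, fderiv_of_notMem_tsupport ℝ hx]

/-- The chain rule tested against a vector field: `∫_D h(u) div X = -∫_D h'(u) ∇u · X`. -/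
theorem IsH1WithGradient.integral_comp_mul_divergence (hD : IsOpen D)
    (hu : IsH1WithGradient D u G)
    {h h' : ℝ → ℝ} (hderiv : ∀ t, HasDerivAt h (h' t) t) (hcont : Continuous h')
    {M M' : ℝ} (hM : ∀ t, |h t| ≤ M) (hM' : ∀ t, |h' t| ≤ M')
    {X : EuclideanSpace ℝ (Fin d) → EuclideanSpace ℝ (Fin d)} (hX : ContDiff ℝ 1 X)
    (hXc : HasCompactSupport X) (hXD : tsupport X ⊆ D) :
    ∫ x in D, h (u x) * divergence X x = -∫ x in D, h' (u x) * ⟪G x, X x⟫_ℝ := by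
  have hXi : ∀ i, ContDiff ℝ 1 (fun x => X x i) := fun i =>
    (EuclideanSpace.proj (𝕜 := ℝ) i : EuclideanSpace ℝ (Fin d) →L[ℝ] ℝ).contDiff.comp hX
  have hsub : ∀ i, Function.support (fun x => X x i) ⊆ tsupport X := fun i x hx =>
    subset_tsupport X fun h0 => hx (by simp [h0])
  have hXic : ∀ i, HasCompactSupport (fun x => X x i) := fun i => hXc.mono' (hsub i)
  have hXiD : ∀ i, tsupport (fun x => X x i) ⊆ D := fun i =>
    (closure_minimal (hsub i) (isClosed_tsupport X)).trans hXD
  have hh : Continuous h := continuous_iff_continuousAt.2 fun t => (hderiv t).continuousAt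
  have hum := hu.memLp_fun.aestronglyMeasurable
  have hint : ∀ i, Integrable
      (fun x => h (u x) * fderiv ℝ (fun y => X y i) x (EuclideanSpace.single i 1))
      (volume.restrict D) := fun i => by
    refine Integrable.bdd_mul (c := M) ?_ (hh.comp_aestronglyMeasurable hum)
      (Eventually.of_forall fun x => hM _)
    exact (((hXi i).continuous_fderiv (by simp)).clm_apply
      continuous_const).integrable_of_hasCompactSupport ((hXic i).fderiv_apply (𝕜 := ℝ) _)
  have hint' : ∀ i, Integrable
      (fun x => h' (u x) * ⟪G x, EuclideanSpace.single i 1⟫_ℝ * X x i)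
      (volume.restrict D) := fun i => by
    simp only [mul_assoc]
    exact Integrable.bdd_mul (c := M')
      (hu.integrable_inner_mul _ (hXi i).continuous (hXic i))
      (hcont.comp_aestronglyMeasurable hum) (Eventually.of_forall fun x => hM' _)
  have e1 : ∀ x, h (u x) * divergence X x
      = ∑ i, h (u x) * fderiv ℝ (fun y => X y i) x (EuclideanSpace.single i 1) := fun x => by
    simp only [divergence, Finset.mul_sum,
      fderiv_euclidean_apply (hX.differentiable (by simp) x)]
  have e2 : ∀ x, h' (u x) * ⟪G x, X x⟫_ℝ
      = ∑ i, h' (u x) * ⟪G x, EuclideanSpace.single i 1⟫_ℝ * X x i := fun x => by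
    simp only [PiLp.inner_apply, Finset.mul_sum]
    refine Finset.sum_congr rfl fun i _ => ?_
    simp [mul_comm, mul_assoc]
  simp_rw [e1, e2]
  rw [integral_finsetSum _ fun i _ => hint i, integral_finsetSum _ fun i _ => hint' i,
    ← Finset.sum_neg_distrib]
  exact Finset.sum_congr rfl fun i _ =>
    hu.integral_comp_mul_fderiv hD hderiv hcont hM hM' (hXi i) (hXic i) (hXiD i) _

end WeakGradient

/-! ### The cubic smoothstep -/

/-- There is a `C¹` function `θ` with values in `[-1, 1]` that climbs from `θ 0 = 0` to `θ = 1` on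
`[1, ∞)`, whose derivative `θ'` vanishes outside `(0, 1)` and is at most `2` in absolute value.
It is the primitive of the positive part of `6 t (1 - t)`. -/
theorem exists_smoothstep : ∃ θ θ' : ℝ → ℝ, (∀ t, HasDerivAt θ (θ' t) t) ∧ Continuous θ' ∧
    (∀ t, |θ t| ≤ 1) ∧ (∀ t, |θ' t| ≤ 2) ∧ θ 0 = 0 ∧ (∀ t, 1 ≤ t → θ t = 1) ∧
    (∀ t, θ' t ≠ 0 → 0 < t ∧ t < 1) := by
  let k : ℝ → ℝ := fun t => max 0 (6 * (t * (1 - t)))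
  have hk : Continuous k := by fun_prop
  have hk0 : ∀ t, 0 ≤ k t := fun t => le_max_left _ _
  have hkne : ∀ t, k t ≠ 0 → 0 < t ∧ t < 1 := by
    intro t ht
    by_contra hcon
    refine ht (max_eq_left ?_)
    rw [not_and_or, not_lt, not_lt] at hcon
    rcases hcon with h | h <;> nlinarith
  let θ : ℝ → ℝ := fun t => ∫ s in (0 : ℝ)..t, k s
  have hθ : ∀ t, HasDerivAt θ (k t) t := fun t => (hk.integral_hasStrictDerivAt 0 t).hasDerivAt
  have hmono : Monotone θ := monotone_of_hasDerivAt_nonneg hθ hk0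
  have hneg : ∀ t ≤ 0, θ t = 0 := fun t ht => by
    refine (intervalIntegral.integral_congr (g := fun _ => 0) fun s hs => ?_).trans (by simp)
    rw [Set.uIcc_of_ge ht] at hs
    by_contra h
    exact absurd (hkne s h).1 (not_lt.2 hs.2)
  have hone : θ 1 = 1 := by
    have : θ 1 = ∫ s in (0 : ℝ)..1, (6 * s - 6 * s ^ 2) := by
      refine intervalIntegral.integral_congr fun s hs => ?_
      rw [Set.uIcc_of_le zero_le_one] at hs
      change max 0 (6 * (s * (1 - s))) = _
      rw [max_eq_right (by nlinarith [hs.1, hs.2])]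
      ring
    rw [this, intervalIntegral.integral_sub
      ((by fun_prop : Continuous fun s : ℝ => 6 * s).intervalIntegrable 0 1)
      ((by fun_prop : Continuous fun s : ℝ => 6 * s ^ 2).intervalIntegrable 0 1),
      intervalIntegral.integral_const_mul, intervalIntegral.integral_const_mul]
    norm_num
  have hge : ∀ t, 1 ≤ t → θ t = 1 := fun t ht => by
    have h0 : ∫ s in (1 : ℝ)..t, k s = 0 := by
      refine (intervalIntegral.integral_congr (g := fun _ => 0) fun s hs => ?_).trans (by simp)
      rw [Set.uIcc_of_le ht] at hs
      by_contra h
      exact absurd (hkne s h).2 (not_lt.2 hs.1)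
    change ∫ s in (0 : ℝ)..t, k s = 1
    rw [← intervalIntegral.integral_add_adjacent_intervals (hk.intervalIntegrable 0 1)
      (hk.intervalIntegrable 1 t), h0, add_zero]
    exact hone
  refine ⟨θ, k, hθ, hk, fun t => abs_le.2 ⟨?_, ?_⟩, fun t => ?_, hneg 0 le_rfl, hge, hkne⟩
  · have := hmono (min_le_left t 0)
    rw [hneg _ (min_le_right t 0)] at this
    linarith
  · have := hmono (le_max_left t 1)
    rwa [hge _ (le_max_right t 1)] at this
  · rw [abs_of_nonneg (hk0 t)]
    exact max_le zero_le_two (by nlinarith [sq_nonneg (2 * t - 1)])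

/-! ### Perimeter of the positivity set -/

section Perimeter

variable {d : ℕ} {D : Set (EuclideanSpace ℝ (Fin d))} {u : EuclideanSpace ℝ (Fin d) → ℝ}
  {G : EuclideanSpace ℝ (Fin d) → EuclideanSpace ℝ (Fin d)}
  {X : EuclideanSpace ℝ (Fin d) → EuclideanSpace ℝ (Fin d)}

theorem IsH1WithGradient.setIntegral_divergence_eq_zero (hD : IsOpen D)
    (hu : IsH1WithGradient D u G) (hX : ContDiff ℝ 1 X) (hXc : HasCompactSupport X)
    (hXD : tsupport X ⊆ D) : ∫ x in D, divergence X x = 0 := by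
  simpa using hu.integral_comp_mul_divergence hD (h := fun _ => 1) (h' := fun _ => 0)
    (fun t => hasDerivAt_const t 1) continuous_const (M := 1) (M' := 0) (by simp) (by simp)
    hX hXc hXD

/-- As `ε → 0` the functions `θ (u / ε)` converge boundedly to the indicator of `{u > 0}`. -/
theorem IsH1WithGradient.tendsto_integral_comp_mul_divergence
    (hu : IsH1WithGradient D u G) (hu0 : ∀ x, 0 ≤ u x) (hX : ContDiff ℝ 1 X)
    (hXc : HasCompactSupport X) {θ : ℝ → ℝ} (hθ : Continuous θ) (hθ1 : ∀ t, |θ t| ≤ 1)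
    (hθ0 : θ 0 = 0) (hθ_one : ∀ t, 1 ≤ t → θ t = 1)
    {ε : ℕ → ℝ} (hε : ∀ n, 0 < ε n) (hεlim : Tendsto ε atTop (𝓝 0)) :
    Tendsto (fun n => ∫ x in D, θ (u x / ε n) * divergence X x) atTop
      (𝓝 (∫ x in D, {x | 0 < u x}.indicator (divergence X) x)) := by
  have hdiv : Integrable (divergence X) (volume.restrict D) :=
    (continuous_divergence hX).integrable_of_hasCompactSupport (hasCompactSupport_divergence hXc)
  refine tendsto_integral_of_dominated_convergence (fun x => |divergence X x|) (fun n => ?_)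
    hdiv.abs (fun n => Eventually.of_forall fun x => ?_) (Eventually.of_forall fun x => ?_)
  · exact ((hθ.comp (continuous_id.div_const (ε n))).comp_aestronglyMeasurable
      hu.memLp_fun.aestronglyMeasurable).mul hdiv.aestronglyMeasurable
  · rw [Real.norm_eq_abs, abs_mul]
    exact mul_le_of_le_one_left (abs_nonneg _) (hθ1 _)
  · rcases (hu0 x).eq_or_lt with h | h
    · simp [← h, hθ0]
    · rw [Set.indicator_of_mem (show x ∈ {x | 0 < u x} from h)]
      refine tendsto_const_nhds.congr' ?_
      filter_upwards [hεlim.eventually (gt_mem_nhds h)] with n hn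
      rw [hθ_one _ ((one_le_div (hε n)).2 hn.le), one_mul]

/-- Passing from `φ.toReal` to `φ`: the positivity sets `{φ.toReal > 0}` and `{φ > 0}` differ in `D`
only by the null set `{φ = ⊤}`. The set `{φ > 0}` is only null measurable. -/
theorem integral_indicator_toReal_pos_eq (hD : MeasurableSet D)
    {φ : EuclideanSpace ℝ (Fin d) → ℝ≥0∞} (hfin : ∀ᵐ x ∂(volume.restrict D), φ x ≠ ⊤)
    (hφ : AEStronglyMeasurable (fun x => (φ x).toReal) (volume.restrict D))
    (f : EuclideanSpace ℝ (Fin d) → ℝ) :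
    ∫ x in D, {x | 0 < (φ x).toReal}.indicator f x = ∫ x in {x | 0 < φ x} ∩ D, f x := by
  have hmeas : NullMeasurableSet {x | 0 < (φ x).toReal} (volume.restrict D) :=
    nullMeasurableSet_lt aemeasurable_const hφ.aemeasurable
  have hset : {x | 0 < (φ x).toReal} =ᵐ[volume.restrict D] {x | 0 < φ x} := by
    filter_upwards [hfin] with x hx
    refine propext ?_
    change 0 < (φ x).toReal ↔ 0 < φ x
    rw [ENNReal.toReal_pos_iff]
    exact ⟨fun h => h.1, fun h => ⟨h, hx.lt_top⟩⟩
  rw [integral_indicator₀ hmeas, Measure.restrict_congr_set hset, Measure.restrict_restrict' hD]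

/-- Young's inequality `2 a √Λ ≤ a² + Λ`, divided by `ε √Λ`. -/
theorem two_div_mul_le_energy {ε Λ a : ℝ} (hε : 0 < ε) (hΛ : 0 < Λ) :
    2 / ε * a ≤ 1 / (ε * √Λ) * (a ^ 2 + Λ) := by
  have hs : 0 < √Λ := Real.sqrt_pos.2 hΛ
  have hsq : √Λ ^ 2 = Λ := Real.sq_sqrt hΛ.le
  rw [div_mul_eq_mul_div, div_mul_eq_mul_div, div_le_div_iff₀ hε (by positivity)]
  nlinarith [mul_nonneg hε.le (sq_nonneg (a - √Λ))]

/-- The energy bound on the layer `{0 < φ ≤ ε}` controls the total variation of `θ (φ / ε)`: its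
gradient lives on that layer and has norm at most `(2 / ε) |∇φ|`. -/
theorem enorm_integral_cutoff_le {φ : EuclideanSpace ℝ (Fin d) → ℝ≥0∞}
    (hD : MeasurableSet D) (hX1 : ∀ x, ‖X x‖ ≤ 1)
    {θ' : ℝ → ℝ} (hθ2 : ∀ t, |θ' t| ≤ 2) (hθne : ∀ t, θ' t ≠ 0 → 0 < t ∧ t < 1)
    {Λ ε C : ℝ} (hΛ : 0 < Λ) (hε : 0 < ε)
    (hbound : (∫⁻ x in {x | 0 < φ x ∧ φ x ≤ ENNReal.ofReal ε} ∩ D, ‖G x‖ₑ ^ 2)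
      + ENNReal.ofReal Λ * volume ({x | 0 < φ x ∧ φ x ≤ ENNReal.ofReal ε} ∩ D)
      ≤ ENNReal.ofReal (C * ε)) :
    ‖∫ x in D, θ' ((φ x).toReal / ε) / ε * ⟪G x, X x⟫_ℝ‖ₑ ≤ ENNReal.ofReal (C / √Λ) := by
  have hs : 0 < √Λ := Real.sqrt_pos.2 hΛ
  set S := {x | 0 < φ x ∧ φ x ≤ ENNReal.ofReal ε} with hS
  set c := ENNReal.ofReal (1 / (ε * √Λ)) with hc
  have hpt : ∀ x, ‖θ' ((φ x).toReal / ε) / ε * ⟪G x, X x⟫_ℝ‖ₑ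
      ≤ S.indicator (fun x => c * (‖G x‖ₑ ^ 2 + ENNReal.ofReal Λ)) x := by
    intro x
    by_cases h0 : θ' ((φ x).toReal / ε) = 0
    · simp [h0]
    obtain ⟨h1, h2⟩ := hθne _ h0
    have hpos : 0 < (φ x).toReal := by
      by_contra hcon
      exact (not_le.2 h1) (div_nonpos_of_nonpos_of_nonneg (not_lt.1 hcon) hε.le)
    have hxS : x ∈ S := by
      obtain ⟨hp, ht⟩ := ENNReal.toReal_pos_iff.1 hpos
      refine ⟨hp, ?_⟩
      rw [← ENNReal.ofReal_toReal ht.ne]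
      exact ENNReal.ofReal_le_ofReal ((div_lt_one hε).1 h2).le
    rw [Set.indicator_of_mem hxS, ← ofReal_norm (θ' _ / ε * _), ← ofReal_norm (G x),
      ← ENNReal.ofReal_pow (norm_nonneg _), ← ENNReal.ofReal_add (by positivity) hΛ.le, hc,
      ← ENNReal.ofReal_mul (by positivity)]
    refine ENNReal.ofReal_le_ofReal (le_trans ?_ (two_div_mul_le_energy hε hΛ))
    rw [norm_mul, norm_div, Real.norm_eq_abs (θ' _), Real.norm_of_nonneg hε.le]
    gcongr
    · exact hθ2 _
    · exact (norm_inner_le_norm _ _).trans (mul_le_of_le_one_right (norm_nonneg _) (hX1 x))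
  calc ‖∫ x in D, θ' ((φ x).toReal / ε) / ε * ⟪G x, X x⟫_ℝ‖ₑ
      ≤ ∫⁻ x in D, ‖θ' ((φ x).toReal / ε) / ε * ⟪G x, X x⟫_ℝ‖ₑ :=
        enorm_integral_le_lintegral_enorm _
    _ ≤ ∫⁻ x in D, S.indicator (fun x => c * (‖G x‖ₑ ^ 2 + ENNReal.ofReal Λ)) x :=
        lintegral_mono hpt
    _ ≤ ∫⁻ x in S, c * (‖G x‖ₑ ^ 2 + ENNReal.ofReal Λ) ∂(volume.restrict D) :=
        lintegral_indicator_le _ _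
    _ = c * ((∫⁻ x in S ∩ D, ‖G x‖ₑ ^ 2) + ENNReal.ofReal Λ * volume (S ∩ D)) := by
        rw [Measure.restrict_restrict' hD, lintegral_const_mul' _ _ ENNReal.ofReal_ne_top,
          lintegral_add_right _ measurable_const, setLIntegral_const]
    _ ≤ c * ENNReal.ofReal (C * ε) := by gcongr
    _ = ENNReal.ofReal (C / √Λ) := by
        rw [hc, ← ENNReal.ofReal_mul (by positivity)]
        congr 1
        field_simp

end Perimeter

/-- Part 1 is the bound for the set `{0 ≤ φ ≤ ε}`, part 2 the one for the set `{0 < φ ≤ ε}`. -/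
theorem lemma2p1 {d : ℕ} (D : Set (EuclideanSpace ℝ (Fin d))) (hD : IsOpen D)
    (φ : EuclideanSpace ℝ (Fin d) → ℝ≥0∞)
    (gradφ : EuclideanSpace ℝ (Fin d) → EuclideanSpace ℝ (Fin d))
    (hfin : ∀ᵐ x ∂(volume.restrict D), φ x ≠ ⊤)
    (hφ : IsH1WithGradient D (fun x => (φ x).toReal) gradφ)
    (Λ : ℝ) (hΛ : 0 < Λ) (ε₀ : ℝ) (hε₀ : 0 < ε₀) (C : ℝ) (hC : 0 < C) :
    ((∀ ε : ℝ, 0 < ε → ε ≤ ε₀ →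
        (∫⁻ x in {x | 0 ≤ φ x ∧ φ x ≤ ENNReal.ofReal ε} ∩ D, ‖gradφ x‖ₑ ^ 2)
          + ENNReal.ofReal Λ * volume ({x | 0 ≤ φ x ∧ φ x ≤ ENNReal.ofReal ε} ∩ D)
          ≤ ENNReal.ofReal (C * ε)) →
      perimeter {x | 0 < φ x} D ≤ ENNReal.ofReal (C * √Λ)) ∧
    ((∀ ε : ℝ, 0 < ε → ε ≤ ε₀ →
        (∫⁻ x in {x | 0 < φ x ∧ φ x ≤ ENNReal.ofReal ε} ∩ D, ‖gradφ x‖ₑ ^ 2)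
          + ENNReal.ofReal Λ * volume ({x | 0 < φ x ∧ φ x ≤ ENNReal.ofReal ε} ∩ D)
          ≤ ENNReal.ofReal (C * ε)) →
      perimeter {x | 0 < φ x} D ≤ ENNReal.ofReal (C / √Λ)) := by
  let ε : ℕ → ℝ := fun n => ε₀ * (1 / ((n : ℝ) + 1))
  have hε : ∀ n, 0 < ε n := fun n => by positivity
  have hεle : ∀ n, ε n ≤ ε₀ := fun n => by
    refine mul_le_of_le_one_right hε₀.le ?_
    rw [div_le_one (by positivity)]
    linarith [(Nat.cast_nonneg n : (0 : ℝ) ≤ n)]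
  have hεlim : Tendsto ε atTop (𝓝 0) := by
    simpa only [mul_zero] using
      (tendsto_one_div_add_atTop_nhds_zero_nat (𝕜 := ℝ)).const_mul ε₀
  refine ⟨fun hyp => ?_, fun hyp => ?_⟩
  -- The layer `{0 ≤ φ ≤ ε}` contains `{φ = 0}`, so letting `ε → 0` shows that `{φ = 0}` is null;
  -- then `{φ > 0}` has full measure in `D`, and its perimeter is zero.
  · have hnull : volume ({x | φ x = 0} ∩ D) = 0 := by
      have hle : ∀ n, ENNReal.ofReal Λ * volume ({x | φ x = 0} ∩ D)
          ≤ ENNReal.ofReal (C * ε n) := fun n => by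
        refine le_trans ?_ (le_add_self.trans (hyp (ε n) (hε n) (hεle n)))
        gcongr
        intro (hx : φ _ = 0)
        simp [hx]
      have hlim : Tendsto (fun n => ENNReal.ofReal (C * ε n)) atTop (𝓝 0) := by
        simpa using ENNReal.tendsto_ofReal (hεlim.const_mul C)
      have h0 := le_antisymm (ge_of_tendsto' hlim hle) zero_le
      exact (mul_eq_zero.1 h0).resolve_left (ENNReal.ofReal_pos.2 hΛ).ne'
    refine iSup₂_le fun X hX => ?_
    obtain ⟨hX1, hXc, hXD, -⟩ := hX
    have hset : ({x | 0 < φ x} ∩ D : Set _) =ᵐ[volume] D := by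
      filter_upwards [measure_eq_zero_iff_ae_notMem.1 hnull] with x hx
      exact propext ⟨fun h => h.2, fun h => ⟨pos_iff_ne_zero.2 fun h0 => hx ⟨h0, h⟩, h⟩⟩
    rw [setIntegral_congr_set hset, hφ.setIntegral_divergence_eq_zero hD hX1 hXc hXD]
    simp
  · obtain ⟨θ, θ', hθ, hθ'c, hθ1, hθ'2, hθ0, hθ_one, hθne⟩ := exists_smoothstep
    have hθc : Continuous θ := continuous_iff_continuousAt.2 fun t => (hθ t).continuousAt
    refine iSup₂_le fun X hX => ?_
    obtain ⟨hXs, hXc, hXD, hX1⟩ := hX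
    have hlim := hφ.tendsto_integral_comp_mul_divergence (fun x => ENNReal.toReal_nonneg) hXs hXc
      hθc hθ1 hθ0 hθ_one hε hεlim
    rw [integral_indicator_toReal_pos_eq hD.measurableSet hfin
      hφ.memLp_fun.aestronglyMeasurable] at hlim
    refine le_of_tendsto' (ENNReal.tendsto_ofReal hlim) fun n => ?_
    have hn := hφ.integral_comp_mul_divergence hD (h := fun t => θ (t / ε n))
      (h' := fun t => θ' (t / ε n) / ε n) (M := 1) (M' := 2 / ε n)
      (fun t => by
        have := (hθ (t / ε n)).comp t ((hasDerivAt_id t).div_const (ε n))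
        rwa [mul_one_div] at this)
      ((hθ'c.comp (continuous_id.div_const _)).div_const _) (fun t => hθ1 _)
      (fun t => by
        rw [abs_div, abs_of_pos (hε n)]
        exact div_le_div_of_nonneg_right (hθ'2 _) (hε n).le) hXs hXc hXD
    rw [hn]
    refine le_trans ?_ (enorm_integral_cutoff_le hD.measurableSet hX1 hθ'2 hθne hΛ (hε n)
      (hyp (ε n) (hε n) (hεle n)))
    rw [← enorm_neg, ← ofReal_norm]
    exact ENNReal.ofReal_le_ofReal (le_abs_self _)
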